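/- Let $f:S^1\to S^1$ be an orientation-preserving homeomorphism of the circle without periodic points, let $\mu$ be its invariant Borel probability measure, and let $\alpha\in(0,1)$ be its (irrational) rotation number. Let $H(0)=0$, $H(x)=\{1/x\}$ be the Gauss map, and put $a_n=\lfloor 1/H^n(\alpha)\rfloor$, so that $\alpha=[a_0,a_1,\dots]=\cfrac{1}{a_0+\cfrac{1}{a_1+\cdots}}$. Let $q_0=1$, $q_1=a_0$, $q_{k+1}=a_kq_k+q_{k-1}$ be the denominators of the truncations $p_n/q_n=[a_0,\dots,a_{n-1}]$. For $\beta=[b_0,b_1,\dots]\in[0,1]$ put $$\Gamma^n(\alpha,\beta)=\bigl(H^n(\alpha),\,[a_{n-1},a_{n-2},\dots,a_0,b_0,b_1,\dots]\bigr).$$ Fix a point $z\in S^1$ and, for $n\ge1$, let $J_n$ be the closed arc containing $z$ with endpoints $f^{q_{n-1}}(z)$ and $f^{q_n}(z)$. For a measurable set $U$ with $\mu(U)>0$ let $\tau_U(x)=\inf\{k\ge1: f^k(x)\in U\}$ and let $$\tilde F_U(t)=\frac{1}{\mu(U)}\,\mu\bigl(U\cap\{\mu(U)\,\tau_U\le t\}\bigr)$$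 be the distribution function of the normalized return time to $U$. Let $n_1<n_2<\cdots$ be integers such that, for some $\beta\in[0,1]$, $\Gamma^{n_i}(\alpha,\beta)\to(\theta,\omega)$ with $\theta>0$ and $\omega<1$. Then $\tilde F_{J_{n_i}}$ converges weakly to $$\tilde F_\sigma(t)=\begin{cases}0 & \text{if } t<\dfrac{(1+\theta)\omega}{1+\theta\omega},\\[2mm] \dfrac{\theta}{1+\theta} & \text{if } \dfrac{(1+\theta)\omega}{1+\theta\omega}\le t<\dfrac{1+\theta}{1+\theta\omega},\\[2mm] 1 & \text{if } t\ge\dfrac{1+\theta}{1+\theta\omega},\end{cases}$$ that is, $\tilde F_\sigma$ is non-decreasing and right-continuous and $\tilde F_{J_{n_i}}(t)\to\tilde F_\sigma(t)$ at every point $t$ at which $\tilde F_\sigma$ is continuous. -/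

import Mathlib

open MeasureTheory Filter Topology
open scoped ENNReal

namespace CircleReturn

/-! ### Orientation preserving circle homeomorphisms and the rotation number -/

/-- `F` is a lift of the circle map `f` to the real line: a continuous non-decreasing map with
`F (x + 1) = F x + 1` that covers `f`. The circle is `UnitAddCircle = ℝ / ℤ`. -/
def IsLift (F : CircleDeg1Lift) (f : UnitAddCircle ≃ₜ UnitAddCircle) : Prop :=
  Continuous F ∧ ∀ x : ℝ, f (x : UnitAddCircle) = ((F x : ℝ) : UnitAddCircle)

/-- A circle homeomorphism preserves the orientation if it has a non-decreasing lift of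
degree one. -/
def OrientationPreserving (f : UnitAddCircle ≃ₜ UnitAddCircle) : Prop :=
  ∃ F : CircleDeg1Lift, IsLift F f

/-- The rotation number in `[0, 1)`: the fractional part of the translation number of a lift. -/
noncomputable def rotationNumber (f : UnitAddCircle ≃ₜ UnitAddCircle)
    (hf : OrientationPreserving f) : ℝ :=
  Int.fract (CircleDeg1Lift.translationNumber hf.choose)

/-- Two lifts of the same homeomorphism differ by an integer translation. -/
theorem IsLift.exists_int {F G : CircleDeg1Lift} {f : UnitAddCircle ≃ₜ UnitAddCircle}
    (hF : IsLift F f) (hG : IsLift G f) : ∃ m : ℤ, ∀ x, F x = G x + m := by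
  have hint : ∀ x, ∃ m : ℤ, F x - G x = m := by
    intro x
    have h := (hF.2 x).symm.trans (hG.2 x)
    have h2 : ((F x - G x : ℝ) : UnitAddCircle) = 0 := by
      rw [AddCircle.coe_sub, h, sub_self]
    obtain ⟨m, hm⟩ := (AddCircle.coe_eq_zero_iff (1 : ℝ)).1 h2
    exact ⟨m, by rw [← hm]; simp⟩
  have hc : Continuous fun x => F x - G x := hF.1.sub hG.1
  obtain ⟨m, hm⟩ := hint 0
  refine ⟨m, fun x => ?_⟩
  have hd : DiscreteTopology (Set.range ((↑) : ℤ → ℝ)) :=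
    Int.isClosedEmbedding_coe_real.isEmbedding.toHomeomorph.symm.isEmbedding.discreteTopology
  have key := isPreconnected_univ.constant_of_mapsTo (S := (Set.univ : Set ℝ))
    (T := Set.range ((↑) : ℤ → ℝ)) ⟨hd⟩ hc.continuousOn
    (fun y _ => by obtain ⟨k, hk⟩ := hint y; exact ⟨k, hk.symm⟩)
    (Set.mem_univ x) (Set.mem_univ 0)
  have key' : F x - G x = m := key.trans hm
  linarith

/-- The rotation number does not depend on the lift. -/
theorem rotationNumber_eq {F : CircleDeg1Lift} {f : UnitAddCircle ≃ₜ UnitAddCircle}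
    (hf : OrientationPreserving f) (hF : IsLift F f) :
    rotationNumber f hf = Int.fract (CircleDeg1Lift.translationNumber F) := by
  obtain ⟨m, hm⟩ := IsLift.exists_int hf.choose_spec hF
  have hE : hf.choose = (CircleDeg1Lift.translate (Multiplicative.ofAdd (m : ℝ))) * F := by
    ext x
    rw [CircleDeg1Lift.mul_apply, CircleDeg1Lift.translate_apply, hm x, add_comm]
  have hcomm : Commute
      ((CircleDeg1Lift.translate (Multiplicative.ofAdd (m : ℝ)) : CircleDeg1Liftˣ) :
        CircleDeg1Lift) F := by
    rw [CircleDeg1Lift.commute_iff_commute]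
    intro x
    simp only [CircleDeg1Lift.translate_apply]
    exact (F.map_int_add m x).symm
  rw [rotationNumber, hE, CircleDeg1Lift.translationNumber_mul_of_commute hcomm,
    CircleDeg1Lift.translationNumber_translate, Int.fract_intCast_add]

/-! ### Continued fractions -/

/-- The Gauss map `H α = {1 / α}`; `H 0 = 0` because `1 / 0 = 0` here. -/
noncomputable def gaussMap (x : ℝ) : ℝ := Int.fract (1 / x)

/-- The partial quotients of `α = [a₀, a₁, …] = 1 / (a₀ + 1 / (a₁ + ⋯))`, namely
`aₙ = ⌊1 / Hⁿ α⌋`. -/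
noncomputable def digit (α : ℝ) (n : ℕ) : ℕ := ⌊1 / gaussMap^[n] α⌋₊

/-- The denominators `qₙ` of the truncations `pₙ / qₙ = [a₀, …, aₙ₋₁]` of order `n`. -/
noncomputable def convDenom (α : ℝ) : ℕ → ℕ
  | 0 => 1
  | 1 => digit α 0
  | n + 2 => digit α (n + 1) * convDenom α (n + 1) + convDenom α n

/-- The value of `[aₙ₋₁, aₙ₋₂, …, a₀, b₀, b₁, …]`, where `aⱼ` are the partial quotients of `α` and
`β = [b₀, b₁, …]`. -/
noncomputable def backwardFraction (α β : ℝ) : ℕ → ℝ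
  | 0 => β
  | n + 1 => 1 / (digit α n + backwardFraction α β n)

/-- `Γⁿ(α, β) = (Hⁿ α, [aₙ₋₁, …, a₀, b₀, b₁, …])`: the `n`-th iterate at `(α, β)` of the natural
extension of the Gauss map. -/
noncomputable def Gam (n : ℕ) (α β : ℝ) : ℝ × ℝ :=
  (gaussMap^[n] α, backwardFraction α β n)

/-! ### Renormalization intervals -/

open Classical in
/-- Of the two closed arcs of the circle with endpoints `a` and `b`, the one that contains `z`. -/
noncomputable def arcThrough (a z b : UnitAddCircle) : Set UnitAddCircle :=
  if btw a z b then Set.cIcc a b else Set.cIcc b a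

/-- The renormalization interval `Jₙ` at `z` (for `n ≥ 1`) of a circle homeomorphism with rotation
number `α`: the closed arc through `z` with endpoints `f^{qₙ₋₁} z` and `f^{qₙ} z`. -/
noncomputable def renormInterval (f : UnitAddCircle ≃ₜ UnitAddCircle) (α : ℝ) (z : UnitAddCircle)
    (n : ℕ) : Set UnitAddCircle :=
  arcThrough (f^[convDenom α (n - 1)] z) z (f^[convDenom α n] z)

/-! ### Return times and their distribution -/

/-- The return / hitting time `τ_U x = inf {k ≥ 1 : T^k x ∈ U}` (`⊤` if there is no such `k`). -/
noncomputable def hitTime {X : Type*} (T : X → X) (U : Set X) (x : X) : ℕ∞ :=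
  ⨅ k : {k : ℕ // 1 ≤ k ∧ T^[k] x ∈ U}, ((k : ℕ) : ℕ∞)

/-- The distribution function of the normalized return time to `U`:
`t ↦ μ (U ∩ {τ_U * μ U ≤ t}) / μ U`. -/
noncomputable def returnDistribution {X : Type*} [MeasurableSpace X] (μ : Measure X) (T : X → X)
    (U : Set X) (t : ℝ) : ℝ :=
  μ.real (U ∩ {x | ((((hitTime T U x : ℕ∞) : ℝ≥0∞) * μ U : ℝ≥0∞) : EReal) ≤ (t : EReal)}) /
    μ.real U

/-- Weak convergence `Fₙ ⇒ F`: `F` is non-decreasing and right continuous, and `Fₙ t → F t` at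
every point `t` of continuity of `F`. -/
def ConvergesWeakly (Fn : ℕ → ℝ → ℝ) (F : ℝ → ℝ) : Prop :=
  Monotone F ∧ (∀ t, ContinuousWithinAt F (Set.Ici t) t) ∧
    ∀ t, ContinuousAt F t → Tendsto (fun n => Fn n t) atTop (𝓝 (F t))

/-- The limiting return time distribution with parameters `θ`, `ω`. -/
noncomputable def limitReturnLaw (θ ω t : ℝ) : ℝ :=
  if t < (1 + θ) * ω / (1 + θ * ω) then 0
  else if t < (1 + θ) / (1 + θ * ω) then θ / (1 + θ)
  else 1

end CircleReturn

/-!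
The return times to `Jₙ` are those of a rotation. A lift `G` of `f` with translation number `α` is
semiconjugate, by a monotone map `h` of degree one that need not be continuous, to the translation
by `α` (`exists_semiconj_add`). The induced map `Φ` of the circle carries `μ` to a probability
measure invariant under the rotation by `α`. As `f` has no periodic point, `α` is irrational, and
this measure is Haar measure (`map_circleMap_eq_volume`). Since `h` is monotone, `Jₙ` lies between
the preimages under `Φ` of an open and a closed arc with the same endpoints, so nothing about
injectivity or continuity of `h` is needed: the endpoints have measure zero.

Put `dₙ = |qₙ α - pₙ|`. The numbers `qₙ α - pₙ` alternate in sign, so the image of `Jₙ` is an arc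
consisting of a part of length `dₙ₋₁` and a part of length `dₙ` on either side of the image of `z`.
The first part returns after `qₙ` steps, as the rotation by `qₙ α` moves it by `dₙ` towards the
second one, and the second part returns after `qₙ₋₁` steps. They do not return earlier: the
vectors `(qₙ, pₙ)` and `(qₙ₋₁, pₙ₋₁)` form a basis of the integer lattice, and if
`(k, m) = u (qₙ, pₙ) + v (qₙ₋₁, pₙ₋₁)` with `k` positive and too small, then the signs of `u`
and `v` make the displacement `k α - m` too large to stay in the arc (`displacement_of_lt_left`,
`displacement_of_lt_right`). With `dₙ / dₙ₋₁ = Hⁿ α`, where `H` is the Gauss map, and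
`qₙ dₙ₋₁ + qₙ₋₁ dₙ = 1` the return law of `Jₙ` becomes exactly the limit law with the parameters
`Hⁿ α` and `qₙ₋₁ / qₙ = [aₙ₋₁, …, a₀]` (`returnDistribution_renormInterval`).

The backward continued fraction forgets its tail `β` at an exponential rate
(`abs_backwardFraction_sub_le`), so the parameters converge to `(θ, ω)`, and away from its two jumps
the limit law depends continuously on them (`tendsto_limitReturnLaw`).
-/

namespace CircleReturn

/-! ### The semiconjugacy with a rotation -/

/-- Among the lifts of a circle homeomorphism there is one whose translation number is the
rotation number itself, not just equal to it modulo `1`. -/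
theorem exists_isLift_translationNumber_eq (f : UnitAddCircle ≃ₜ UnitAddCircle)
    (hf : OrientationPreserving f) :
    ∃ G : CircleDeg1Lift, IsLift G f ∧ G.translationNumber = rotationNumber f hf := by
  obtain ⟨F, hF⟩ := id hf
  set m : ℤ := ⌊F.translationNumber⌋ with hm
  set u : CircleDeg1Liftˣ := CircleDeg1Lift.translate (Multiplicative.ofAdd (-(m : ℝ))) with hu
  have happ : ∀ x, (u * F : CircleDeg1Lift) x = F x - m := fun x => by
    rw [CircleDeg1Lift.mul_apply, hu, CircleDeg1Lift.translate_apply]; ring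
  refine ⟨u * F, ⟨?_, fun x => ?_⟩, ?_⟩
  · simp only [funext happ]
    exact hF.1.sub continuous_const
  · rw [happ, hF.2 x, AddCircle.coe_sub, eq_comm, sub_eq_self]
    exact (AddCircle.coe_eq_zero_iff (1 : ℝ)).2 ⟨m, by simp⟩
  · rw [rotationNumber_eq _ hF]
    have hcomm : Commute (u : CircleDeg1Lift) F := by
      rw [CircleDeg1Lift.commute_iff_commute]
      intro x
      simp only [hu, CircleDeg1Lift.translate_apply]
      rw [neg_add_eq_sub, neg_add_eq_sub, F.map_sub_int]
    rw [CircleDeg1Lift.translationNumber_mul_of_commute hcomm, hu,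
      CircleDeg1Lift.translationNumber_translate, neg_add_eq_sub, hm, Int.self_sub_floor]

theorem coe_eq_coe_iff {x y : ℝ} :
    (x : UnitAddCircle) = (y : UnitAddCircle) ↔ ∃ m : ℤ, x = y + m := by
  rw [← sub_eq_zero, ← AddCircle.coe_sub, AddCircle.coe_eq_zero_iff]
  constructor
  · rintro ⟨m, hm⟩
    exact ⟨m, by simp at hm; linarith⟩
  · rintro ⟨m, hm⟩
    exact ⟨m, by simp [hm]⟩

theorem coe_sub_intCast (x : ℝ) (m : ℤ) : ((x - m : ℝ) : UnitAddCircle) = x :=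
  coe_eq_coe_iff.2 ⟨-m, by push_cast; ring⟩

theorem IsLift.bijective {G : CircleDeg1Lift} {f : UnitAddCircle ≃ₜ UnitAddCircle}
    (hG : IsLift G f) : Function.Bijective G := by
  refine ⟨fun x y hxy => ?_, hG.1.surjective G.tendsto_atTop G.tendsto_atBot⟩
  have h : f x = f y := by rw [hG.2, hG.2, hxy]
  obtain ⟨m, hm⟩ := coe_eq_coe_iff.1 (f.injective h)
  rw [hm, G.map_add_int] at hxy
  rw [hm, left_eq_add.1 hxy.symm, add_zero]

theorem IsLift.iterate {G : CircleDeg1Lift} {f : UnitAddCircle ≃ₜ UnitAddCircle}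
    (hG : IsLift G f) (k : ℕ) (x : ℝ) : f^[k] (x : UnitAddCircle) = (G^[k] x : ℝ) := by
  induction k with
  | zero => rfl
  | succ k ih => rw [Function.iterate_succ_apply', ih, hG.2, Function.iterate_succ_apply']

theorem irrational_translationNumber {G : CircleDeg1Lift} {f : UnitAddCircle ≃ₜ UnitAddCircle}
    (hG : IsLift G f) (hper : Function.periodicPts f = ∅) : Irrational G.translationNumber := by
  rintro ⟨r, hr⟩
  have hpow : (G ^ r.den).translationNumber = (r.num : ℝ) := by
    rw [CircleDeg1Lift.translationNumber_pow, ← hr]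
    exact_mod_cast Rat.den_mul_eq_num r
  obtain ⟨x, hx⟩ := ((G ^ r.den).translationNumber_eq_int_iff (G.continuous_pow hG.1 _)).1 hpow
  have hmem : (x : UnitAddCircle) ∈ Function.periodicPts f := by
    refine ⟨r.den, r.den_pos, ?_⟩
    rw [Function.IsPeriodicPt, Function.IsFixedPt, hG.iterate, ← CircleDeg1Lift.coe_pow, hx]
    exact coe_eq_coe_iff.2 ⟨r.num, rfl⟩
  simp [hper] at hmem

/-- The map of the circle covered by a monotone map of degree one of the line, which need not be
continuous. -/
noncomputable def circleMap (h : CircleDeg1Lift) (x : UnitAddCircle) : UnitAddCircle :=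
  (h (AddCircle.measurableEquivIoc 1 0 x : ℝ) : ℝ)

theorem circleMap_coe (h : CircleDeg1Lift) (x : ℝ) :
    circleMap h (x : UnitAddCircle) = (h x : ℝ) := by
  have hx : ((AddCircle.measurableEquivIoc 1 0 (x : UnitAddCircle) : ℝ) : UnitAddCircle) = x :=
    (AddCircle.measurableEquivIoc (1 : ℝ) 0).symm_apply_apply (x : UnitAddCircle)
  obtain ⟨m, hm⟩ := coe_eq_coe_iff.1 hx
  rw [circleMap, hm, h.map_add_int]
  exact coe_eq_coe_iff.2 ⟨m, rfl⟩

theorem measurable_circleMap (h : CircleDeg1Lift) : Measurable (circleMap h) :=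
  AddCircle.measurable_mk'.comp (h.monotone.measurable.comp
    (measurable_subtype_coe.comp (AddCircle.measurableEquivIoc (1 : ℝ) 0).measurable))

/-- An invertible lift is semiconjugate to the translation by its translation number. -/
theorem exists_semiconj_add {G : CircleDeg1Lift} (hG : Function.Bijective G) :
    ∃ h : CircleDeg1Lift, ∀ x, h (G x) = h x + G.translationNumber := by
  obtain ⟨h, hh⟩ := CircleDeg1Lift.semiconj_of_bijective_of_translationNumber_eq hG
    (CircleDeg1Lift.isUnit_iff_bijective.1
      (CircleDeg1Lift.translate (Multiplicative.ofAdd G.translationNumber)).isUnit)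
    (CircleDeg1Lift.translationNumber_translate _).symm
  refine ⟨h, fun x => ?_⟩
  rw [hh.eq, CircleDeg1Lift.translate_apply, add_comm]

theorem circleMap_comp {G h : CircleDeg1Lift} {f : UnitAddCircle ≃ₜ UnitAddCircle} {α : ℝ}
    (hG : IsLift G f) (hh : ∀ x, h (G x) = h x + α) (x : UnitAddCircle) :
    circleMap h (f x) = circleMap h x + (α : UnitAddCircle) := by
  obtain ⟨x, rfl⟩ := QuotientAddGroup.mk_surjective x
  change circleMap h (f (x : UnitAddCircle)) = circleMap h (x : UnitAddCircle) + _
  rw [hG.2, circleMap_coe, circleMap_coe, hh, AddCircle.coe_add]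

/-! ### Unique ergodicity of irrational rotations -/

/-- The translations that preserve a finite measure form a closed set, so a probability measure
invariant under one translation with dense orbits is invariant under all of them. -/
theorem eq_volume_of_map_add_eq {ν : Measure UnitAddCircle} [IsProbabilityMeasure ν]
    {a : UnitAddCircle} (ha : DenseRange (fun k : ℤ => k • a)) (hν : ν.map (a + ·) = ν) :
    ν = volume := by
  have hmap : ∀ (g : UnitAddCircle) (φ : BoundedContinuousFunction UnitAddCircle ℝ),
      ∫ x, φ x ∂(ν.map (g + ·)) = ∫ x, φ (g + x) ∂ν := fun g φ =>
    integral_map (measurable_const_add g).aemeasurable φ.continuous.aestronglyMeasurable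
  have hzmul : ∀ k : ℤ, ν.map (k • a + ·) = ν := by
    let S : AddSubgroup UnitAddCircle :=
      { carrier := {g | ν.map (g + ·) = ν}
        zero_mem' := by simp
        add_mem' := by
          intro g g' hg hg'
          have : (g + g' + · : UnitAddCircle → UnitAddCircle) = (g + ·) ∘ (g' + ·) := by
            ext x; simp [add_assoc]
          rw [Set.mem_ofPred_eq, this, ← Measure.map_map (measurable_const_add g)
            (measurable_const_add g'), hg', hg]
        neg_mem' := by
          intro g hg
          rw [Set.mem_ofPred_eq] at hg ⊢
          conv_lhs => rw [← hg]
          rw [Measure.map_map (measurable_const_add _) (measurable_const_add g)]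
          have : ((-g + ·) ∘ (g + ·) : UnitAddCircle → UnitAddCircle) = id := by ext x; simp
          rw [this, Measure.map_id] }
    exact fun k => S.zsmul_mem (show a ∈ S from hν) k
  have hall : ∀ (φ : BoundedContinuousFunction UnitAddCircle ℝ) (g : UnitAddCircle),
      ∫ x, φ (g + x) ∂ν = ∫ x, φ x ∂ν := by
    intro φ
    have hc : Continuous fun g : UnitAddCircle => ∫ x, φ (g + x) ∂ν := by
      refine continuous_of_dominated (bound := fun _ => ‖φ‖)
        (fun g => (φ.continuous.comp (continuous_const_add g)).aestronglyMeasurable)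
        (fun g => ae_of_all _ fun x => φ.norm_coe_le_norm _) (integrable_const _)
        (ae_of_all _ fun x => φ.continuous.comp (continuous_add_const x))
    refine fun g => congrFun (ha.equalizer hc continuous_const ?_) g
    ext k
    simp only [Function.comp_apply]
    rw [← hmap, hzmul]
  have : ν.IsAddLeftInvariant := ⟨fun g =>
    ext_of_forall_integral_eq_of_IsFiniteMeasure fun φ => by rw [hmap, hall]⟩
  have : ν.IsAddHaarMeasure := Measure.isAddHaarMeasure_of_isCompact_nonempty_interior ν
    Set.univ isCompact_univ (by simp) (by simp) (by simp)
  have : IsProbabilityMeasure (volume : Measure UnitAddCircle) := ⟨UnitAddCircle.measure_univ⟩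
  exact Measure.isAddHaarMeasure_eq_of_isProbabilityMeasure _ _

/-- The semiconjugacy to an irrational rotation carries the invariant measure to Haar measure. -/
theorem map_circleMap_eq_volume {G h : CircleDeg1Lift} {f : UnitAddCircle ≃ₜ UnitAddCircle}
    {α : ℝ} (hα : Irrational α) (hG : IsLift G f) (hh : ∀ x, h (G x) = h x + α)
    {μ : Measure UnitAddCircle} [IsProbabilityMeasure μ] (hμ : MeasurePreserving f μ μ) :
    μ.map (circleMap h) = volume := by
  have := Measure.isProbabilityMeasure_map (μ := μ) (measurable_circleMap h).aemeasurable
  refine eq_volume_of_map_add_eq (AddCircle.denseRange_zsmul_coe_iff.2 (by simpa using hα)) ?_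
  have hcomp : ((α : UnitAddCircle) + ·) ∘ circleMap h = circleMap h ∘ f := by
    ext x
    simp [circleMap_comp hG hh, add_comm]
  rw [Measure.map_map (measurable_const_add _) (measurable_circleMap h), hcomp,
    ← Measure.map_map (measurable_circleMap h) hμ.measurable, hμ.map_eq]

theorem volume_image_coe_Ioo {a b : ℝ} (hab : b ≤ a + 1) :
    volume ((fun x : ℝ => (x : UnitAddCircle)) '' Set.Ioo a b) = ENNReal.ofReal (b - a) := by
  have hopen : IsOpen ((fun x : ℝ => (x : UnitAddCircle)) '' Set.Ioo a b) :=
    QuotientAddGroup.isOpenMap_coe _ isOpen_Ioo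
  rw [← (UnitAddCircle.measurePreserving_mk a).measure_preimage
    hopen.measurableSet.nullMeasurableSet, Measure.restrict_apply
    (AddCircle.measurable_mk' hopen.measurableSet), ← Real.volume_Ioo]
  congr 1
  ext x
  constructor
  · rintro ⟨⟨y, hy, hyx⟩, hx⟩
    obtain ⟨m, rfl⟩ := coe_eq_coe_iff.1 hyx
    have h1 : (-1 : ℝ) < m := by linarith [hy.1, hx.2]
    have h2 : (m : ℝ) < 1 := by linarith [hy.2, hx.1]
    have h3 : m = 0 := by
      have h1' : (-1 : ℤ) < m := by exact_mod_cast h1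
      have h2' : m < 1 := by exact_mod_cast h2
      omega
    simpa [h3] using hy
  · exact fun hx => ⟨⟨x, hx, rfl⟩, hx.1, by linarith [hx.2]⟩

/-! ### Arcs of the circle -/

theorem btw_coe_iff_le {a x b : ℝ} (hx : x ∈ Set.Ico a (a + 1)) (hb : b ∈ Set.Ioc a (a + 1)) :
    btw (a : UnitAddCircle) x b ↔ x ≤ b := by
  refine QuotientAddGroup.btw_coe_iff.trans ?_
  rw [(toIcoMod_eq_self _).2 hx, (toIocMod_eq_self _).2 hb]

theorem cIcc_coe {a b : ℝ} (hab : a < b) (hb : b < a + 1) :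
    Set.cIcc (a : UnitAddCircle) b = (fun x : ℝ => (x : UnitAddCircle)) '' Set.Icc a b := by
  ext x
  constructor
  · intro hx
    have hmem := AddCircle.coe_equivIco (a := a) (y := x) (p := (1 : ℝ))
    set y := AddCircle.equivIco (1 : ℝ) a x with hy
    rw [← hmem] at hx ⊢
    exact ⟨y, ⟨y.2.1, (btw_coe_iff_le y.2 ⟨hab, hb.le⟩).1 hx⟩, rfl⟩
  · rintro ⟨y, hy, rfl⟩
    exact (btw_coe_iff_le ⟨hy.1, hy.2.trans_lt hb⟩ ⟨hab, hb.le⟩).2 hy.2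

/-- If `z` lies strictly between `a` and `b` on a stretch of the line shorter than the circle, then
the arc through `z` is the one covered by `[a, b]`, whichever endpoint is named first. -/
theorem arcThrough_coe {a z b : ℝ} (haz : a < z) (hzb : z < b) (hb : b < a + 1) :
    arcThrough (a : UnitAddCircle) z b = (fun x : ℝ => (x : UnitAddCircle)) '' Set.Icc a b ∧
    arcThrough (b : UnitAddCircle) z a = (fun x : ℝ => (x : UnitAddCircle)) '' Set.Icc a b := by
  have h1 : btw (a : UnitAddCircle) z b :=
    (btw_coe_iff_le ⟨haz.le, hzb.trans hb⟩ ⟨haz.trans hzb, hb.le⟩).2 hzb.le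
  have h2 : ¬ btw (b : UnitAddCircle) z a := fun h =>
    hzb.not_ge ((btw_coe_iff_le ⟨(haz.trans hzb).le, hb⟩ ⟨haz, (hzb.trans hb).le⟩).1
      (btw_cyclic_right h))
  rw [arcThrough, arcThrough, if_pos h1, if_neg h2, cIcc_coe (haz.trans hzb) hb]
  exact ⟨rfl, rfl⟩

/-! ### Return times to an arc under a map semiconjugate to a rotation -/

theorem hitTime_eq {X : Type*} {T : X → X} {U : Set X} {x : X} {q : ℕ} (hq : 1 ≤ q)
    (hmem : T^[q] x ∈ U) (hnot : ∀ k, 1 ≤ k → k < q → T^[k] x ∉ U) : hitTime T U x = q := by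
  refine le_antisymm (iInf_le (fun k : {k : ℕ // 1 ≤ k ∧ T^[k] x ∈ U} => ((k : ℕ) : ℕ∞))
    ⟨q, hq, hmem⟩) (le_iInf fun k => ?_)
  by_contra! h
  exact hnot k k.2.1 (by exact_mod_cast h) k.2.2

section Lattice

variable {α : ℝ} {Q q : ℕ} {P p : ℤ}

/-- Every integer vector is an integer combination of the two rows of a unimodular matrix. -/
theorem exists_lattice_coordinates (hdet : Q * p - q * P = 1) (k m : ℤ) :
    ∃ u v : ℤ, k = u * Q + v * q ∧
      k * α - m = u * (Q * α - P) - v * (p - q * α) := by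
  refine ⟨k * p - m * q, Q * m - P * k, by linear_combination (-k) * hdet, ?_⟩
  have h : (Q * p - q * P : ℝ) = 1 := by exact_mod_cast hdet
  push_cast
  linear_combination (m - k * α) * h

/-- No rotation step before time `Q` takes a point of the left part `(-r, 0)` of an arc
`[-r, s]` back to the arc, where `s = Q α - P` and `r = p - q α`. -/
theorem displacement_of_lt_left (hdet : Q * p - q * P = 1)
    (hs : 0 < Q * α - P) (hr : 0 < p - q * α) {k : ℕ} {m : ℤ} (hk : 1 ≤ k) (hkQ : k < Q) :
    k * α - m ≤ -(p - q * α) ∨ (Q * α - P) + (p - q * α) ≤ k * α - m := by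
  obtain ⟨u, v, huv, hd⟩ := exists_lattice_coordinates (α := α) hdet k m
  rw [Int.cast_natCast] at hd
  have hk' : (1 : ℤ) ≤ k := by exact_mod_cast hk
  have hkQ' : (k : ℤ) < Q := by exact_mod_cast hkQ
  rcases le_or_gt u 0 with hu | hu
  · have hv : 1 ≤ v := by
      by_contra! hv
      nlinarith [mul_nonneg (neg_nonneg.2 hu) (Int.natCast_nonneg Q),
        mul_nonneg (show 0 ≤ -v by omega) (Int.natCast_nonneg q)]
    have hu' : (u : ℝ) ≤ 0 := by exact_mod_cast hu
    have hv' : (1 : ℝ) ≤ v := by exact_mod_cast hv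
    left
    nlinarith
  · have hv : v ≤ -1 := by
      by_contra! hv
      nlinarith [mul_nonneg (show 0 ≤ u - 1 by omega) (Int.natCast_nonneg Q),
        mul_nonneg (show 0 ≤ v by omega) (Int.natCast_nonneg q)]
    have hu' : (1 : ℝ) ≤ u := by exact_mod_cast hu
    have hv' : (v : ℝ) ≤ -1 := by exact_mod_cast hv
    right
    nlinarith

/-- The counterpart of `displacement_of_lt_left` for the right part `(0, s)` of the arc and
times before `q`. -/
theorem displacement_of_lt_right (hdet : Q * p - q * P = 1)
    (hs : 0 < Q * α - P) (hr : 0 < p - q * α) {k : ℕ} {m : ℤ} (hk : 1 ≤ k) (hkq : k < q) :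
    k * α - m ≤ -((Q * α - P) + (p - q * α)) ∨ Q * α - P ≤ k * α - m := by
  -- The reflection of the circle exchanges the two parts.
  have h := displacement_of_lt_left (α := -α) (Q := q) (q := Q) (P := -p) (p := -P) (m := -m)
    (by linear_combination hdet) (by push_cast; linarith) (by push_cast; linarith) hk hkq
  push_cast at h
  rcases h with h | h
  · right; linarith
  · left; linarith

end Lattice

section ReturnTimes

variable {f H : UnitAddCircle → UnitAddCircle} {α c : ℝ} {Q q : ℕ} {P p : ℤ}
  {J : Set UnitAddCircle}

theorem semiconj_iterate_of_forall_add (hH : ∀ x, H (f x) = H x + (α : UnitAddCircle)) (k : ℕ)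
    {x : UnitAddCircle} {y : ℝ} (hy : (y : UnitAddCircle) = H x) :
    H (f^[k] x) = ((y + k * α : ℝ) : UnitAddCircle) := by
  induction k with
  | zero => simp [hy]
  | succ k ih =>
    rw [Function.iterate_succ_apply', hH, ih, ← AddCircle.coe_add]
    congr 1
    push_cast
    ring

/-- A point can only return to the arc at time `k` if `k α` is, modulo `1`, a displacement
that takes its position `y` into `[a, b]`. -/
theorem iterate_notMem_of_displacement (hH : ∀ x, H (f x) = H x + (α : UnitAddCircle))
    {a b : ℝ} (hJH : ∀ x ∈ J, H x ∈ (fun x : ℝ => (x : UnitAddCircle)) '' Set.Icc a b)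
    {x : UnitAddCircle} {y : ℝ} (hy : (y : UnitAddCircle) = H x) {k : ℕ}
    (hk : ∀ m : ℤ, k * α - m < a - y ∨ b - y < k * α - m) : f^[k] x ∉ J := by
  intro hx
  obtain ⟨w, hw, hwx⟩ := hJH _ hx
  rw [semiconj_iterate_of_forall_add hH k hy] at hwx
  obtain ⟨m, hm⟩ := coe_eq_coe_iff.1 hwx
  rcases hk (-m) with h | h <;> push_cast at h
  · linarith [hw.1]
  · linarith [hw.2]

theorem iterate_mem_of_displacement (hH : ∀ x, H (f x) = H x + (α : UnitAddCircle))
    {a b : ℝ} (hHJ : ∀ x, H x ∈ (fun x : ℝ => (x : UnitAddCircle)) '' Set.Ioo a b → x ∈ J)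
    {x : UnitAddCircle} {y : ℝ} (hy : (y : UnitAddCircle) = H x) {k : ℕ} {m : ℤ}
    (hk : y + (k * α - m) ∈ Set.Ioo a b) : f^[k] x ∈ J := by
  refine hHJ _ ⟨_, hk, ?_⟩
  rw [semiconj_iterate_of_forall_add hH k hy]
  exact coe_eq_coe_iff.2 ⟨-m, by push_cast; ring⟩

/-- With `s = Q α - P` and `r = p - q α`, the left part of the arc `[c - r, c + s]` returns after
exactly `Q` steps. -/
theorem hitTime_left (hH : ∀ x, H (f x) = H x + (α : UnitAddCircle))
    (hJH : ∀ x ∈ J, H x ∈ (fun x : ℝ => (x : UnitAddCircle)) ''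
      Set.Icc (c - (p - q * α)) (c + (Q * α - P)))
    (hHJ : ∀ x, H x ∈ (fun x : ℝ => (x : UnitAddCircle)) ''
      Set.Ioo (c - (p - q * α)) (c + (Q * α - P)) → x ∈ J)
    (hdet : Q * p - q * P = 1) (hs : 0 < Q * α - P) (hr : 0 < p - q * α) (hQ : 1 ≤ Q)
    {x : UnitAddCircle}
    (hx : H x ∈ (fun x : ℝ => (x : UnitAddCircle)) '' Set.Ioo (c - (p - q * α)) c) :
    hitTime f J x = Q := by
  obtain ⟨y, hy, hyx⟩ := hx
  refine hitTime_eq hQ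
    (iterate_mem_of_displacement hH hHJ hyx (m := P) ⟨by linarith [hy.1], by linarith [hy.2]⟩)
    fun k hk hkQ => iterate_notMem_of_displacement hH hJH hyx fun m => ?_
  rcases displacement_of_lt_left hdet hs hr (m := m) hk hkQ with h | h
  · left; linarith [hy.2]
  · right; linarith [hy.1]

/-- With `s = Q α - P` and `r = p - q α`, the right part of the arc `[c - r, c + s]` returns after
exactly `q` steps. -/
theorem hitTime_right (hH : ∀ x, H (f x) = H x + (α : UnitAddCircle))
    (hJH : ∀ x ∈ J, H x ∈ (fun x : ℝ => (x : UnitAddCircle)) ''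
      Set.Icc (c - (p - q * α)) (c + (Q * α - P)))
    (hHJ : ∀ x, H x ∈ (fun x : ℝ => (x : UnitAddCircle)) ''
      Set.Ioo (c - (p - q * α)) (c + (Q * α - P)) → x ∈ J)
    (hdet : Q * p - q * P = 1) (hs : 0 < Q * α - P) (hr : 0 < p - q * α) (hq : 1 ≤ q)
    {x : UnitAddCircle}
    (hx : H x ∈ (fun x : ℝ => (x : UnitAddCircle)) '' Set.Ioo c (c + (Q * α - P))) :
    hitTime f J x = q := by
  obtain ⟨y, hy, hyx⟩ := hx
  refine hitTime_eq hq
    (iterate_mem_of_displacement hH hHJ hyx (m := p) ⟨by linarith [hy.1], by linarith [hy.2]⟩)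
    fun k hk hkq => iterate_notMem_of_displacement hH hJH hyx fun m => ?_
  rcases displacement_of_lt_right hdet hs hr (m := m) hk hkq with h | h
  · left; linarith [hy.2]
  · right; linarith [hy.1]

/-- The distribution of the return time to `U` when, up to a null set, `U` splits into two parts
on each of which the return time is constant. -/
theorem returnDistribution_of_two_parts {X : Type*} [MeasurableSpace X] {μ : Measure X}
    [IsFiniteMeasure μ] {T : X → X} {U V W : Set X} (hV : MeasurableSet V)
    (hVU : V ⊆ U) (hWU : W ⊆ U) (hVW : Disjoint V W) (hnull : μ (U \ (V ∪ W)) = 0) {N M : ℕ}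
    (hVt : ∀ x ∈ V, hitTime T U x = N) (hWt : ∀ x ∈ W, hitTime T U x = M) (t : ℝ) :
    returnDistribution μ T U t =
      ((if N * (μ.real V + μ.real W) ≤ t then μ.real V else 0) +
        (if M * (μ.real V + μ.real W) ≤ t then μ.real W else 0)) / (μ.real V + μ.real W) := by
  have hsplit : ∀ E ⊆ U, μ.real E = μ.real (V ∩ E) + μ.real (W ∩ E) := by
    intro E hE
    have hE1 : E =ᵐ[μ] ((V ∪ W) ∩ E : Set X) := by
      refine (ae_eq_set.2 ⟨measure_mono_null ?_ hnull, by
        rw [Set.sdiff_eq_empty.2 Set.inter_subset_right, measure_empty]⟩)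
      rintro x ⟨hx, hx'⟩
      exact ⟨hE hx, fun h => hx' ⟨h, hx⟩⟩
    rw [measureReal_congr hE1, ← measureReal_inter_add_sdiff (s := (V ∪ W) ∩ E) hV]
    congr 2
    · ext x; simp only [Set.mem_inter_iff, Set.mem_union]; tauto
    · ext x
      have hx : x ∈ V → x ∉ W := fun hv => Set.disjoint_left.1 hVW hv
      simp only [Set.mem_inter_iff, Set.mem_union, Set.mem_sdiff]; tauto
  have hU : μ.real U = μ.real V + μ.real W := by
    rw [hsplit U subset_rfl, Set.inter_eq_left.2 hVU, Set.inter_eq_left.2 hWU]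
  have hcond : ∀ n : ℕ, ((((n : ℕ∞) : ℝ≥0∞) * μ U : ℝ≥0∞) : EReal) ≤ (t : EReal) ↔
      n * (μ.real V + μ.real W) ≤ t := by
    intro n
    have h : (((n : ℕ∞) : ℝ≥0∞) * μ U : ℝ≥0∞) = ENNReal.ofReal (n * (μ.real V + μ.real W)) := by
      rw [ENNReal.ofReal_mul (Nat.cast_nonneg n), ← hU, ofReal_measureReal]
      simp
    rw [h, EReal.coe_ennreal_ofReal, max_eq_left (by positivity), EReal.coe_le_coe_iff]
  have hpart : ∀ {A : Set X} {n : ℕ}, A ⊆ U → (∀ x ∈ A, hitTime T U x = n) →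
      μ.real (A ∩ (U ∩ {x | ((((hitTime T U x : ℕ∞) : ℝ≥0∞) * μ U : ℝ≥0∞) : EReal) ≤
        (t : EReal)})) = if n * (μ.real V + μ.real W) ≤ t then μ.real A else 0 := by
    intro A n hAU hA
    split_ifs with h
    · congr 1
      refine Set.inter_eq_left.2 fun x hx => ⟨hAU hx, ?_⟩
      rw [Set.mem_ofPred_eq, hA x hx]
      exact (hcond n).2 h
    · convert measureReal_empty
      refine Set.eq_empty_of_forall_notMem fun x hx => h ?_
      have hx2 := hx.2.2
      rw [Set.mem_ofPred_eq, hA x hx.1] at hx2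
      exact (hcond n).1 hx2
  rw [returnDistribution, hsplit _ Set.inter_subset_left, hpart hVU hVt, hpart hWU hWt, hU]

theorem disjoint_image_coe_Ioo {a b c : ℝ} (hca : c ≤ a + 1) :
    Disjoint ((fun x : ℝ => (x : UnitAddCircle)) '' Set.Ioo a b)
      ((fun x : ℝ => (x : UnitAddCircle)) '' Set.Ioo b c) := by
  rw [Set.disjoint_left]
  rintro _ ⟨x, hx, rfl⟩ ⟨y, hy, hyx⟩
  obtain ⟨m, hm⟩ := coe_eq_coe_iff.1 hyx
  have h1 : (0 : ℝ) < m := by linarith [hx.2, hy.1]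
  have h2 : (m : ℝ) < 1 := by linarith [hx.1, hy.2]
  have h1' : (0 : ℤ) < m := by exact_mod_cast h1
  have h2' : m < 1 := by exact_mod_cast h2
  omega

theorem volume_eq_zero_of_finite {S : Set UnitAddCircle} (hS : S.Finite) : volume S = 0 := by
  rw [← Set.biUnion_of_singleton S, measure_biUnion_null_iff hS.countable]
  intro x _
  rw [← Metric.closedBall_zero, AddCircle.volume_closedBall]
  simp

/-- The return time distribution of an arc with image `[c - r, c + s]` under the semiconjugacy,
where `s = Q α - P` and `r = p - q α` come from a unimodular pair of integer vectors. -/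
theorem returnDistribution_of_semiconj {μ : Measure UnitAddCircle} [IsProbabilityMeasure μ]
    (hHm : Measurable H) (hμH : μ.map H = volume)
    (hH : ∀ x, H (f x) = H x + (α : UnitAddCircle))
    (hJH : ∀ x ∈ J, H x ∈ (fun x : ℝ => (x : UnitAddCircle)) ''
      Set.Icc (c - (p - q * α)) (c + (Q * α - P)))
    (hHJ : ∀ x, H x ∈ (fun x : ℝ => (x : UnitAddCircle)) ''
      Set.Ioo (c - (p - q * α)) (c + (Q * α - P)) → x ∈ J)
    (hdet : Q * p - q * P = 1) (hs : 0 < Q * α - P) (hr : 0 < p - q * α) (hQ : 1 ≤ Q)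
    (hq : 1 ≤ q) (hrs : (p - q * α) + (Q * α - P) < 1) (t : ℝ) :
    returnDistribution μ f J t =
      ((if Q * ((p - q * α) + (Q * α - P)) ≤ t then p - q * α else 0) +
        (if q * ((p - q * α) + (Q * α - P)) ≤ t then Q * α - P else 0)) /
        ((p - q * α) + (Q * α - P)) := by
  set s := Q * α - P with hs_def
  set r := p - q * α with hr_def
  have hmeas : ∀ a b : ℝ, MeasurableSet ((fun x : ℝ => (x : UnitAddCircle)) '' Set.Ioo a b) :=
    fun a b => (QuotientAddGroup.isOpenMap_coe _ isOpen_Ioo).measurableSet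
  have hreal : ∀ a b : ℝ, a ≤ b → b ≤ a + 1 →
      μ.real (H ⁻¹' ((fun x : ℝ => (x : UnitAddCircle)) '' Set.Ioo a b)) = b - a := by
    intro a b hab hb
    rw [measureReal_def, ← Measure.map_apply hHm (hmeas a b), hμH, volume_image_coe_Ioo hb,
      ENNReal.toReal_ofReal (by linarith)]
  have hV := hreal (c - r) c (by linarith) (by linarith)
  have hW := hreal c (c + s) (by linarith) (by linarith)
  rw [sub_sub_cancel] at hV
  rw [add_sub_cancel_left] at hW
  have key := returnDistribution_of_two_parts (μ := μ) (T := f) (U := J)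
    (W := H ⁻¹' ((fun x : ℝ => (x : UnitAddCircle)) '' Set.Ioo c (c + s)))
    (hHm (hmeas (c - r) c))
    (fun x hx => hHJ x (Set.image_mono (Set.Ioo_subset_Ioo_right (by linarith)) hx))
    (fun x hx => hHJ x (Set.image_mono (Set.Ioo_subset_Ioo_left (by linarith)) hx))
    ((disjoint_image_coe_Ioo (by linarith)).preimage H) ?_
    (fun x hx => hitTime_left hH hJH hHJ hdet hs hr hQ hx)
    (fun x hx => hitTime_right hH hJH hHJ hdet hs hr hq hx) t
  · rwa [hV, hW] at key
  -- What is left of the arc sits over the three points `c - r`, `c` and `c + s`.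
  · have hfin : Set.Finite ({((c - r : ℝ) : UnitAddCircle), (c : UnitAddCircle),
        ((c + s : ℝ) : UnitAddCircle)} : Set UnitAddCircle) := by simp
    refine measure_mono_null (t := H ⁻¹' _) ?_
      ((Measure.map_apply hHm hfin.measurableSet).symm.trans
        (by rw [hμH]; exact volume_eq_zero_of_finite hfin))
    rintro x ⟨hxJ, hx⟩
    obtain ⟨y, hy, hyx⟩ := hJH x hxJ
    rw [Set.mem_preimage, ← hyx]
    rcases eq_or_lt_of_le hy.1 with h1 | h1
    · simp [← h1]
    rcases eq_or_lt_of_le hy.2 with h2 | h2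
    · simp [h2]
    rcases lt_trichotomy y c with h3 | h3 | h3
    · exact absurd (Or.inl ⟨y, ⟨h1, h3⟩, hyx⟩) hx
    · simp [h3]
    · exact absurd (Or.inr ⟨y, ⟨h3, h2⟩, hyx⟩) hx

end ReturnTimes

/-- The arc through `z` with endpoints at times `Q` and `q`, which lie on opposite sides of `z`,
matches the corresponding arc for the rotation up to endpoints; hence its return law. -/
theorem returnDistribution_arcThrough {G h : CircleDeg1Lift} {f : UnitAddCircle ≃ₜ UnitAddCircle}
    {α : ℝ} (hα : Irrational α) (hG : IsLift G f) (hh : ∀ x, h (G x) = h x + α)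
    {μ : Measure UnitAddCircle} [IsProbabilityMeasure μ] (hμ : MeasurePreserving f μ μ)
    (z : UnitAddCircle) {Q q : ℕ} {P p : ℤ}
    (hdet : Q * p - q * P = 1) (hs : 0 < Q * α - P) (hr : 0 < p - q * α) (hQ : 1 ≤ Q)
    (hq : 1 ≤ q) (hrs : (p - q * α) + (Q * α - P) < 1) {J : Set UnitAddCircle}
    (hJ : J = arcThrough (f^[q] z) z (f^[Q] z) ∨ J = arcThrough (f^[Q] z) z (f^[q] z)) (t : ℝ) :
    returnDistribution μ f J t =
      ((if Q * ((p - q * α) + (Q * α - P)) ≤ t then p - q * α else 0) +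
        (if q * ((p - q * α) + (Q * α - P)) ≤ t then Q * α - P else 0)) /
        ((p - q * α) + (Q * α - P)) := by
  obtain ⟨z, rfl⟩ := QuotientAddGroup.mk_surjective z
  change J = arcThrough (f^[q] (z : UnitAddCircle)) (z : UnitAddCircle) _ ∨
    J = arcThrough _ (z : UnitAddCircle) (f^[q] (z : UnitAddCircle)) at hJ
  have hiter : ∀ k : ℕ, h (G^[k] z) = h z + k * α := by
    intro k
    induction k with
    | zero => simp
    | succ k ih => rw [Function.iterate_succ_apply', hh, ih]; push_cast; ring
  set a := G^[q] z - p with ha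
  set b := G^[Q] z - P with hb
  have hha : h a = h z - (p - q * α) := by rw [ha, h.map_sub_int, hiter]; ring
  have hhb : h b = h z + (Q * α - P) := by rw [hb, h.map_sub_int, hiter]; ring
  have hlt : ∀ {x y : ℝ}, h x < h y → x < y := fun hxy => h.monotone.reflect_lt hxy
  have haz : a < z := hlt (by linarith)
  have hzb : z < b := hlt (by linarith)
  have hba : b < a + 1 := hlt (by rw [h.map_add_one]; linarith)
  have hfa : f^[q] (z : UnitAddCircle) = (a : ℝ) := by rw [hG.iterate, ha, coe_sub_intCast]
  have hfb : f^[Q] (z : UnitAddCircle) = (b : ℝ) := by rw [hG.iterate, hb, coe_sub_intCast]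
  have hJ' : J = (fun x : ℝ => (x : UnitAddCircle)) '' Set.Icc a b := by
    rw [hfa, hfb, (arcThrough_coe haz hzb hba).1, (arcThrough_coe haz hzb hba).2, or_self] at hJ
    exact hJ
  refine returnDistribution_of_semiconj (c := h z) (measurable_circleMap h)
    (map_circleMap_eq_volume hα hG hh hμ) (circleMap_comp hG hh) ?_ ?_ hdet hs hr hQ hq hrs t
  · rw [hJ', ← hha, ← hhb]
    rintro _ ⟨x, hx, rfl⟩
    exact ⟨h x, ⟨h.monotone hx.1, h.monotone hx.2⟩, (circleMap_coe h x).symm⟩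
  · rw [hJ', ← hha, ← hhb]
    intro x hx
    obtain ⟨x, rfl⟩ := QuotientAddGroup.mk_surjective x
    obtain ⟨y, hy, hyx⟩ := hx
    obtain ⟨m, hm⟩ := coe_eq_coe_iff.1 (hyx.trans (circleMap_coe h x))
    rw [← h.map_add_int] at hm
    rw [hm] at hy
    exact ⟨x + m, ⟨(hlt hy.1).le, (hlt hy.2).le⟩, coe_eq_coe_iff.2 ⟨m, rfl⟩⟩

/-! ### Continued fractions -/

theorem irrational_gaussMap {x : ℝ} (hx : Irrational x) : Irrational (gaussMap x) := by
  have h : Irrational (1 / x) := by simpa using hx.inv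
  exact h.sub_intCast _

theorem gaussMap_iterate_irrational {α : ℝ} (hα : Irrational α) (n : ℕ) :
    Irrational (gaussMap^[n] α) := by
  induction n with
  | zero => exact hα
  | succ n ih => rw [Function.iterate_succ_apply']; exact irrational_gaussMap ih

theorem gaussMap_iterate_mem_Ioo {α : ℝ} (hα : Irrational α) (h0 : 0 < α) (h1 : α < 1) (n : ℕ) :
    gaussMap^[n] α ∈ Set.Ioo (0 : ℝ) 1 := by
  cases n with
  | zero => exact ⟨h0, h1⟩
  | succ n =>
    have hne := (gaussMap_iterate_irrational hα (n + 1)).ne_zero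
    rw [Function.iterate_succ_apply'] at hne ⊢
    exact ⟨(Int.fract_nonneg _).lt_of_ne' hne, Int.fract_lt_one _⟩

theorem digit_add_gaussMap {α : ℝ} (hα : Irrational α) (h0 : 0 < α) (h1 : α < 1) (n : ℕ) :
    (digit α n + gaussMap^[n + 1] α) * gaussMap^[n] α = 1 := by
  have hpos := (gaussMap_iterate_mem_Ioo hα h0 h1 n).1
  have h : (digit α n : ℝ) = ⌊1 / gaussMap^[n] α⌋ := natCast_floor_eq_intCast_floor (by positivity)
  rw [h, Function.iterate_succ_apply', gaussMap, Int.floor_add_fract, one_div_mul_cancel hpos.ne']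

theorem one_le_digit {α : ℝ} (hα : Irrational α) (h0 : 0 < α) (h1 : α < 1) (n : ℕ) :
    1 ≤ digit α n := by
  have h := gaussMap_iterate_mem_Ioo hα h0 h1 n
  refine Nat.le_floor ?_
  rw [Nat.cast_one]
  exact one_le_one_div h.1 h.2.le

/-- The numerators `pₙ` of the truncations `pₙ / qₙ = [a₀, …, aₙ₋₁]`. -/
noncomputable def convNum (α : ℝ) : ℕ → ℕ
  | 0 => 0
  | 1 => 1
  | n + 2 => digit α (n + 1) * convNum α (n + 1) + convNum α n

/-- The product `α · H α ⋯ Hⁿ α`, which is the distance `|qₙ α - pₙ|`. -/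
noncomputable def convDist (α : ℝ) : ℕ → ℝ
  | 0 => α
  | n + 1 => gaussMap^[n + 1] α * convDist α n

theorem convDist_pos {α : ℝ} (hα : Irrational α) (h0 : 0 < α) (h1 : α < 1) (n : ℕ) :
    0 < convDist α n := by
  induction n with
  | zero => exact h0
  | succ n ih => exact mul_pos (gaussMap_iterate_mem_Ioo hα h0 h1 _).1 ih

theorem convDenom_mul_sub_convNum {α : ℝ} (hα : Irrational α) (h0 : 0 < α) (h1 : α < 1) (n : ℕ) :
    convDenom α n * α - convNum α n = (-1) ^ n * convDist α n := by
  induction n using Nat.twoStepInduction with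
  | zero => simp [convDenom, convNum, convDist]
  | one =>
    have h := digit_add_gaussMap hα h0 h1 0
    simp only [Function.iterate_zero, id_eq] at h
    simp only [convDenom, convNum, convDist]
    push_cast
    linear_combination h
  | more n ih1 ih2 =>
    have h := digit_add_gaussMap hα h0 h1 (n + 1)
    simp only [convDenom, convNum, convDist] at ih2 ⊢
    push_cast
    linear_combination ih1 + digit α (n + 1) * ih2 - (-1) ^ n * convDist α n * h

theorem convDenom_convNum_det (α : ℝ) (n : ℕ) :
    (convDenom α (n + 1) * convNum α n - convDenom α n * convNum α (n + 1) : ℤ) =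
      (-1) ^ (n + 1) := by
  induction n with
  | zero => simp [convDenom, convNum]
  | succ n ih =>
    simp only [convDenom, convNum]
    push_cast
    linear_combination -ih

theorem one_le_convDenom {α : ℝ} (hα : Irrational α) (h0 : 0 < α) (h1 : α < 1) (n : ℕ) :
    1 ≤ convDenom α n := by
  induction n using Nat.twoStepInduction with
  | zero => exact le_rfl
  | one => exact one_le_digit hα h0 h1 0
  | more n ih1 ih2 => exact ih1.trans (Nat.le_add_left _ _)

theorem convDenom_add_le {α : ℝ} (hα : Irrational α) (h0 : 0 < α) (h1 : α < 1) (n : ℕ) :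
    convDenom α (n + 1) + convDenom α n ≤ convDenom α (n + 2) :=
  Nat.add_le_add_right (Nat.le_mul_of_pos_left _ (one_le_digit hα h0 h1 _)) _

theorem convDenom_le_succ {α : ℝ} (hα : Irrational α) (h0 : 0 < α) (h1 : α < 1) (n : ℕ) :
    convDenom α n ≤ convDenom α (n + 1) := by
  cases n with
  | zero => exact one_le_convDenom hα h0 h1 1
  | succ n => exact (Nat.le_add_right _ _).trans (convDenom_add_le hα h0 h1 n)

theorem two_le_convDenom {α : ℝ} (hα : Irrational α) (h0 : 0 < α) (h1 : α < 1) (n : ℕ) :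
    2 ≤ convDenom α (n + 2) :=
  (add_le_add (one_le_convDenom hα h0 h1 (n + 1)) (one_le_convDenom hα h0 h1 n)).trans
    (convDenom_add_le hα h0 h1 n)

/-- The two towers over the parts of the renormalization interval, of heights `qₙ₊₁` and `qₙ`, have
total length `1`. -/
theorem convDenom_mul_convDist_add {α : ℝ} (hα : Irrational α) (h0 : 0 < α) (h1 : α < 1) (n : ℕ) :
    convDenom α (n + 1) * convDist α n + convDenom α n * convDist α (n + 1) = 1 := by
  have hdet : (convDenom α (n + 1) * convNum α n - convDenom α n * convNum α (n + 1) : ℝ) =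
      (-1) ^ (n + 1) := by exact_mod_cast convDenom_convNum_det α n
  have hn := convDenom_mul_sub_convNum hα h0 h1 n
  have hn1 := convDenom_mul_sub_convNum hα h0 h1 (n + 1)
  have hsq : ((-1 : ℝ) ^ n) ^ 2 = 1 := by rw [← pow_mul, mul_comm, pow_mul]; simp
  rw [pow_succ] at hdet hn1
  linear_combination (-((-1 : ℝ) ^ n)) * (convDenom α (n + 1) * hn - convDenom α n * hn1 + hdet) +
    (1 - convDenom α (n + 1) * convDist α n - convDenom α n * convDist α (n + 1)) * hsq

theorem backwardFraction_zero_succ {α : ℝ} (hα : Irrational α) (h0 : 0 < α) (h1 : α < 1) (n : ℕ) :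
    backwardFraction α 0 (n + 1) = convDenom α n / convDenom α (n + 1) := by
  induction n with
  | zero => simp [backwardFraction, convDenom]
  | succ n ih =>
    have h : (convDenom α (n + 1) : ℝ) ≠ 0 :=
      Nat.cast_ne_zero.2 (Nat.one_le_iff_ne_zero.1 (one_le_convDenom hα h0 h1 (n + 1)))
    rw [backwardFraction, ih, show convDenom α (n + 1 + 1) =
      digit α (n + 1) * convDenom α (n + 1) + convDenom α n from rfl]
    push_cast
    field_simp

theorem backwardFraction_mem_Icc {α : ℝ} (hα : Irrational α) (h0 : 0 < α) (h1 : α < 1) {β : ℝ}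
    (hβ : β ∈ Set.Icc (0 : ℝ) 1) (n : ℕ) : backwardFraction α β n ∈ Set.Icc (0 : ℝ) 1 := by
  induction n with
  | zero => exact hβ
  | succ n ih =>
    have hd : (1 : ℝ) ≤ digit α n := by exact_mod_cast one_le_digit hα h0 h1 n
    have hpos : (0 : ℝ) < digit α n + backwardFraction α β n := by linarith [ih.1]
    exact ⟨by rw [backwardFraction]; positivity, (div_le_one hpos).2 (by linarith [ih.1])⟩

/-- Two steps of the backward continued fraction contract by the factor `1 / 4`. -/
theorem abs_backwardFraction_sub_le {α : ℝ} (hα : Irrational α) (h0 : 0 < α) (h1 : α < 1) {β γ : ℝ}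
    (hβ : β ∈ Set.Icc (0 : ℝ) 1) (hγ : γ ∈ Set.Icc (0 : ℝ) 1) (n : ℕ) :
    |backwardFraction α β n - backwardFraction α γ n| ≤ 2 * (1 / 2) ^ n := by
  have hmem := fun n => backwardFraction_mem_Icc hα h0 h1 hβ n
  have hmem' := fun n => backwardFraction_mem_Icc hα h0 h1 hγ n
  have hone : ∀ n, |backwardFraction α β n - backwardFraction α γ n| ≤ 1 := fun n =>
    abs_sub_le_iff.2 ⟨by linarith [(hmem n).2, (hmem' n).1], by linarith [(hmem n).1, (hmem' n).2]⟩
  induction n using Nat.twoStepInduction with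
  | zero => linarith [hone 0]
  | one => linarith [hone 1]
  | more n ih1 _ =>
    have ha : (1 : ℝ) ≤ digit α n := by exact_mod_cast one_le_digit hα h0 h1 n
    have hb : (1 : ℝ) ≤ digit α (n + 1) := by exact_mod_cast one_le_digit hα h0 h1 (n + 1)
    have hx := (hmem n).1
    have hy := (hmem' n).1
    simp only [backwardFraction]
    set x := backwardFraction α β n
    set y := backwardFraction α γ n
    set a : ℝ := (digit α n : ℝ)
    set b : ℝ := (digit α (n + 1) : ℝ)
    have hX : 2 ≤ b * (a + x) + 1 := by nlinarith
    have hY : 2 ≤ b * (a + y) + 1 := by nlinarith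
    have hax : 0 < a + x := by linarith
    have hay : 0 < a + y := by linarith
    have hdiff : 1 / (b + 1 / (a + x)) - 1 / (b + 1 / (a + y)) =
        (x - y) / ((b * (a + x) + 1) * (b * (a + y) + 1)) := by
      have hX' : b * (a + x) + 1 ≠ 0 := by positivity
      have hY' : b * (a + y) + 1 ≠ 0 := by positivity
      field_simp
      ring
    have h4 : 4 ≤ (b * (a + x) + 1) * (b * (a + y) + 1) := by nlinarith
    rw [hdiff, abs_div, abs_of_pos (show 0 < (b * (a + x) + 1) * (b * (a + y) + 1) by linarith),
      div_le_iff₀ (by linarith), pow_add]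
    have hpow : (0 : ℝ) < (1 / 2) ^ n := by positivity
    nlinarith

/-! ### Return laws of the renormalization intervals and their limit -/

/-- The return law of `Jₙ` has the form of the limit law, with the parameters `θ = Hⁿ α` and
`ω = qₙ₋₁ / qₙ`. -/
theorem returnDistribution_renormInterval {G h : CircleDeg1Lift}
    {f : UnitAddCircle ≃ₜ UnitAddCircle} {α : ℝ} (hα : Irrational α) (h0 : 0 < α) (h1 : α < 1)
    (hG : IsLift G f) (hh : ∀ x, h (G x) = h x + α)
    {μ : Measure UnitAddCircle} [IsProbabilityMeasure μ] (hμ : MeasurePreserving f μ μ)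
    (z : UnitAddCircle) {n : ℕ} (hn : 2 ≤ n) (t : ℝ) :
    returnDistribution μ f (renormInterval f α z n) t =
      limitReturnLaw (gaussMap^[n] α) (backwardFraction α 0 n) t := by
  obtain ⟨k, rfl⟩ := Nat.exists_eq_add_of_le' hn
  rw [backwardFraction_zero_succ hα h0 h1]
  set d := convDist α (k + 1) with hd
  set d' := convDist α (k + 2) with hd'
  have hdpos : 0 < d := convDist_pos hα h0 h1 _
  have hd'pos : 0 < d' := convDist_pos hα h0 h1 _
  have hθ := gaussMap_iterate_mem_Ioo hα h0 h1 (k + 2)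
  set θ := gaussMap^[k + 2] α
  have hdd' : d' = θ * d := rfl
  have hden := convDenom_mul_convDist_add hα h0 h1 (k + 1)
  have hdet := convDenom_convNum_det α (k + 1)
  have he := convDenom_mul_sub_convNum hα h0 h1 (k + 1)
  have he' := convDenom_mul_sub_convNum hα h0 h1 (k + 2)
  have hq := one_le_convDenom hα h0 h1 (k + 1)
  have hQ := two_le_convDenom hα h0 h1 k
  have hqQ := convDenom_le_succ hα h0 h1 (k + 1)
  rw [← hd] at he
  rw [← hd'] at he'
  rw [← hd, show k + 1 + 1 = k + 2 from rfl, ← hd'] at hden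
  have hJ : renormInterval f α z (k + 2) =
    arcThrough (f^[convDenom α (k + 1)] z) z (f^[convDenom α (k + 2)] z) := rfl
  rw [show k + 1 + 1 = k + 2 from rfl] at hdet hqQ ⊢
  set Q := convDenom α (k + 2)
  set q := convDenom α (k + 1)
  have hqR : (1 : ℝ) ≤ q := by exact_mod_cast hq
  have hQR : (2 : ℝ) ≤ Q := by exact_mod_cast hQ
  have hqQR : (q : ℝ) ≤ Q := by exact_mod_cast hqQ
  have hsum : d + d' < 1 := by nlinarith
  have key : returnDistribution μ f (renormInterval f α z (k + 2)) t =
      ((if Q * (d + d') ≤ t then d else 0) + (if q * (d + d') ≤ t then d' else 0)) / (d + d') := by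
    -- The two endpoints alternate sides of `z` with the parity of `k`.
    rcases Nat.even_or_odd k with hk | hk
    · have hpow : (-1 : ℤ) ^ (k + 2) = 1 := (hk.add even_two).neg_one_pow
      have hpow' : (-1 : ℝ) ^ (k + 2) = 1 := (hk.add even_two).neg_one_pow
      have hpow1 : (-1 : ℝ) ^ (k + 1) = -1 := hk.add_one.neg_one_pow
      have hs : Q * α - (convNum α (k + 2) : ℤ) = d' := by
        push_cast; rw [he', hpow', one_mul]
      have hr : (convNum α (k + 1) : ℤ) - q * α = d := by
        push_cast; rw [hpow1] at he; linarith
      have := returnDistribution_arcThrough hα hG hh hμ z (hdet.trans hpow)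
        (by rw [hs]; exact hd'pos) (by rw [hr]; exact hdpos) (by omega) hq
        (by rw [hs, hr]; exact hsum) (Or.inl hJ) t
      rwa [hs, hr] at this
    · have hpow : (-1 : ℤ) ^ (k + 2) = -1 := (hk.add_even even_two).neg_one_pow
      have hpow' : (-1 : ℝ) ^ (k + 2) = -1 := (hk.add_even even_two).neg_one_pow
      have hpow1 : (-1 : ℝ) ^ (k + 1) = 1 := hk.add_one.neg_one_pow
      have hs : q * α - (convNum α (k + 1) : ℤ) = d := by
        push_cast; rw [he, hpow1, one_mul]
      have hr : (convNum α (k + 2) : ℤ) - Q * α = d' := by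
        push_cast; rw [hpow'] at he'; linarith
      have := returnDistribution_arcThrough hα hG hh hμ z
        (Q := q) (q := Q) (P := convNum α (k + 1)) (p := convNum α (k + 2))
        (by linear_combination -hdet - hpow)
        (by rw [hs]; exact hdpos) (by rw [hr]; exact hd'pos) hq (by omega)
        (by rw [hs, hr]; linarith) (Or.inr hJ) t
      rw [hs, hr] at this
      rw [this, add_comm d' d, add_comm (ite _ d' _)]
  have hQpos : (0 : ℝ) < Q := by linarith
  have hden' : d * (Q + q * θ) = 1 := by rw [hdd'] at hden; linarith
  have hpos : 0 < Q + q * θ := by nlinarith [hθ.1]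
  have hdval : d = 1 / (Q + q * θ) := by rw [eq_div_iff hpos.ne', hden']
  have hT2 : Q * (d + d') = (1 + θ) / (1 + θ * (q / Q)) := by
    rw [hdd', hdval]
    field_simp
  have hT1 : q * (d + d') = (1 + θ) * (q / Q) / (1 + θ * (q / Q)) := by
    rw [hdd', hdval]
    field_simp
  have hle : q * (d + d') ≤ Q * (d + d') := by gcongr
  rw [key, limitReturnLaw, ← hT1, ← hT2]
  have hθ1 : 1 + θ ≠ 0 := by linarith [hθ.1]
  split_ifs with h1 h2 h3 h4 h5 h6 <;> first | linarith | skip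
  · rw [div_self (by positivity)]
  · rw [zero_add, hdd']
    field_simp
  · simp

section LimitLaw

variable {θ ω : ℝ}

theorem limitReturnLaw_of_lt {t : ℝ} (ht : t < (1 + θ) * ω / (1 + θ * ω)) :
    limitReturnLaw θ ω t = 0 := if_pos ht

theorem limitReturnLaw_of_mem_Ico {t : ℝ} (ht : (1 + θ) * ω / (1 + θ * ω) ≤ t)
    (ht' : t < (1 + θ) / (1 + θ * ω)) : limitReturnLaw θ ω t = θ / (1 + θ) := by
  rw [limitReturnLaw, if_neg ht.not_gt, if_pos ht']

theorem limitReturnLaw_of_ge (hT : (1 + θ) * ω / (1 + θ * ω) < (1 + θ) / (1 + θ * ω)) {t : ℝ}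
    (ht : (1 + θ) / (1 + θ * ω) ≤ t) : limitReturnLaw θ ω t = 1 := by
  rw [limitReturnLaw, if_neg (hT.le.trans ht).not_gt, if_neg ht.not_gt]

theorem limitReturnLaw_threshold_lt (hθ : 0 < θ) (hω0 : 0 ≤ ω) (hω : ω < 1) :
    (1 + θ) * ω / (1 + θ * ω) < (1 + θ) / (1 + θ * ω) := by
  have : 0 < 1 + θ * ω := by positivity
  rw [div_lt_div_iff_of_pos_right this]
  nlinarith

theorem monotone_limitReturnLaw (hθ : 0 < θ) : Monotone (limitReturnLaw θ ω) := by
  intro s t hst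
  have h1 : θ / (1 + θ) ≤ 1 := (div_le_one (by linarith)).2 (by linarith)
  have h0 : 0 ≤ θ / (1 + θ) := by positivity
  unfold limitReturnLaw
  split_ifs <;> linarith

theorem continuousWithinAt_Ici_limitReturnLaw
    (hT : (1 + θ) * ω / (1 + θ * ω) < (1 + θ) / (1 + θ * ω)) (t : ℝ) :
    ContinuousWithinAt (limitReturnLaw θ ω) (Set.Ici t) t := by
  have aux : (∀ᶠ s in 𝓝[Set.Ici t] t, limitReturnLaw θ ω s = limitReturnLaw θ ω t) →
      ContinuousWithinAt (limitReturnLaw θ ω) (Set.Ici t) t := fun h =>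
    (continuousWithinAt_const (b := limitReturnLaw θ ω t)).congr_of_eventuallyEq h rfl
  apply aux
  rcases lt_or_ge t ((1 + θ) * ω / (1 + θ * ω)) with h1 | h1
  · filter_upwards [mem_nhdsWithin_of_mem_nhds (Iio_mem_nhds h1)] with s hs
    rw [limitReturnLaw_of_lt h1, limitReturnLaw_of_lt hs]
  rcases lt_or_ge t ((1 + θ) / (1 + θ * ω)) with h2 | h2
  · filter_upwards [mem_nhdsWithin_of_mem_nhds (Iio_mem_nhds h2), self_mem_nhdsWithin] with s hs hs'
    rw [limitReturnLaw_of_mem_Ico h1 h2, limitReturnLaw_of_mem_Ico (h1.trans hs') hs]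
  · filter_upwards [self_mem_nhdsWithin] with s hs
    rw [limitReturnLaw_of_ge hT h2, limitReturnLaw_of_ge hT (h2.trans hs)]

theorem eq_of_continuousAt_of_eventually_nhdsLT {F : ℝ → ℝ} {t c : ℝ} (hF : ContinuousAt F t)
    (hc : ∀ᶠ s in 𝓝[<] t, F s = c) : F t = c :=
  tendsto_nhds_unique (hF.tendsto.mono_left nhdsWithin_le_nhds)
    (tendsto_const_nhds.congr' (hc.mono fun _ h => h.symm))

theorem ne_thresholds_of_continuousAt (hθ : 0 < θ)
    (hT : (1 + θ) * ω / (1 + θ * ω) < (1 + θ) / (1 + θ * ω)) {t : ℝ}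
    (ht : ContinuousAt (limitReturnLaw θ ω) t) :
    t ≠ (1 + θ) * ω / (1 + θ * ω) ∧ t ≠ (1 + θ) / (1 + θ * ω) := by
  constructor
  · intro h
    have := eq_of_continuousAt_of_eventually_nhdsLT ht (c := 0) <| by
      filter_upwards [self_mem_nhdsWithin] with s hs
      exact limitReturnLaw_of_lt (h ▸ hs)
    rw [limitReturnLaw_of_mem_Ico h.ge (h ▸ hT)] at this
    exact absurd this (by positivity)
  · intro h
    have := eq_of_continuousAt_of_eventually_nhdsLT ht (c := θ / (1 + θ)) <| by
      filter_upwards [self_mem_nhdsWithin,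
        mem_nhdsWithin_of_mem_nhds (Ioi_mem_nhds (h ▸ hT))] with s hs hs'
      exact limitReturnLaw_of_mem_Ico (le_of_lt hs') (h ▸ hs)
    rw [limitReturnLaw_of_ge hT h.ge, eq_div_iff (by linarith)] at this
    linarith

/-- Away from its two jumps the limit law depends continuously on the parameters. -/
theorem tendsto_limitReturnLaw {ι : Type*} {l : Filter ι} {u v : ι → ℝ}
    (hu : Tendsto u l (𝓝 θ)) (hv : Tendsto v l (𝓝 ω)) (hθ : 0 < θ) (hω0 : 0 ≤ ω) (hω : ω < 1)
    {t : ℝ} (ht1 : t ≠ (1 + θ) * ω / (1 + θ * ω)) (ht2 : t ≠ (1 + θ) / (1 + θ * ω)) :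
    Tendsto (fun i => limitReturnLaw (u i) (v i) t) l (𝓝 (limitReturnLaw θ ω t)) := by
  have hT := limitReturnLaw_threshold_lt hθ hω0 hω
  have hne : 1 + θ * ω ≠ 0 := by positivity
  have hT1 : Tendsto (fun i => (1 + u i) * v i / (1 + u i * v i)) l
      (𝓝 ((1 + θ) * ω / (1 + θ * ω))) :=
    ((hu.const_add 1).mul hv).div ((hu.mul hv).const_add 1) hne
  have hT2 : Tendsto (fun i => (1 + u i) / (1 + u i * v i)) l (𝓝 ((1 + θ) / (1 + θ * ω))) :=
    (hu.const_add 1).div ((hu.mul hv).const_add 1) hne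
  rcases lt_or_gt_of_ne ht1 with h1 | h1
  · rw [limitReturnLaw_of_lt h1]
    refine tendsto_const_nhds.congr' ?_
    filter_upwards [hT1.eventually_const_lt h1] with i hi
    rw [limitReturnLaw_of_lt hi]
  rcases lt_or_gt_of_ne ht2 with h2 | h2
  · rw [limitReturnLaw_of_mem_Ico h1.le h2]
    refine (hu.div (hu.const_add 1) (by positivity)).congr' ?_
    filter_upwards [hT1.eventually_lt_const h1, hT2.eventually_const_lt h2] with i hi hi'
    rw [limitReturnLaw_of_mem_Ico hi.le hi']
    rfl
  · rw [limitReturnLaw_of_ge hT h2.le]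
    refine tendsto_const_nhds.congr' ?_
    filter_upwards [hT1.eventually_lt hT2 hT, hT2.eventually_lt_const h2] with i hi hi'
    rw [limitReturnLaw_of_ge hi hi'.le]

end LimitLaw

end CircleReturn

open CircleReturn

theorem mainTheorem3
    (f : UnitAddCircle ≃ₜ UnitAddCircle)
    (hf : CircleReturn.OrientationPreserving f)
    (hper : Function.periodicPts f = ∅)
    (μ : MeasureTheory.Measure UnitAddCircle) [MeasureTheory.IsProbabilityMeasure μ]
    (hμ : MeasureTheory.MeasurePreserving f μ μ)
    (z : UnitAddCircle)
    (n : ℕ → ℕ) (hn : StrictMono n)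
    (β θ ω : ℝ) (hβ : β ∈ Set.Icc (0 : ℝ) 1) (hθ : 0 < θ) (hω : ω < 1)
    (hΓ : Filter.Tendsto
      (fun i => CircleReturn.Gam (n i) (CircleReturn.rotationNumber f hf) β)
      Filter.atTop (nhds (θ, ω))) :
    CircleReturn.ConvergesWeakly
      (fun i => CircleReturn.returnDistribution μ f
        (CircleReturn.renormInterval f (CircleReturn.rotationNumber f hf) z (n i)))
      (CircleReturn.limitReturnLaw θ ω) := by
  obtain ⟨G, hG, hGα⟩ := exists_isLift_translationNumber_eq f hf
  obtain ⟨h, hh⟩ := exists_semiconj_add hG.bijective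
  have hα := irrational_translationNumber hG hper
  rw [hGα] at hh hα
  have h0 : 0 < rotationNumber f hf := (Int.fract_nonneg _).lt_of_ne' hα.ne_zero
  have h1 : rotationNumber f hf < 1 := Int.fract_lt_one _
  set α := rotationNumber f hf
  have hu : Tendsto (fun i => gaussMap^[n i] α) atTop (𝓝 θ) :=
    (continuous_fst.tendsto _).comp hΓ
  have hvβ : Tendsto (fun i => backwardFraction α β (n i)) atTop (𝓝 ω) :=
    (continuous_snd.tendsto _).comp hΓ
  have hω0 : 0 ≤ ω := ge_of_tendsto' hvβ fun i => (backwardFraction_mem_Icc hα h0 h1 hβ _).1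
  have hv : Tendsto (fun i => backwardFraction α 0 (n i)) atTop (𝓝 ω) := by
    have hpow : Tendsto (fun i => (2 : ℝ) * (1 / 2) ^ n i) atTop (𝓝 0) := by
      simpa using ((tendsto_pow_atTop_nhds_zero_of_lt_one (by norm_num)
        (by norm_num : (1 / 2 : ℝ) < 1)).comp hn.tendsto_atTop).const_mul 2
    have hdiff := squeeze_zero_norm (fun i => (Real.norm_eq_abs _).trans_le
      (abs_backwardFraction_sub_le hα h0 h1 hβ ⟨le_rfl, zero_le_one⟩ (n i))) hpow
    simpa using hvβ.sub hdiff
  have hT := limitReturnLaw_threshold_lt hθ hω0 hω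
  refine ⟨monotone_limitReturnLaw hθ, continuousWithinAt_Ici_limitReturnLaw hT, fun t ht => ?_⟩
  obtain ⟨ht1, ht2⟩ := ne_thresholds_of_continuousAt hθ hT ht
  refine (tendsto_limitReturnLaw hu hv hθ hω0 hω ht1 ht2).congr' ?_
  filter_upwards [hn.tendsto_atTop.eventually_ge_atTop 2] with i hi
  exact (returnDistribution_renormInterval hα h0 h1 hG hh hμ z hi t).symm
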